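/- Consider a mm-wave cellular network whose macro base stations (tier ${\rm m}$) and small-cell base stations (tier ${\rm s}$) form independent homogeneous Poisson point processes $\Phi_{\rm m},\Phi_{\rm s}$ in $\mathbb R^2$ with densities $\lambda_{\rm m}>0$, $\lambda_{\rm s}\ge 0$, seen from a typical user at the origin; users have density $\lambda_{\rm u}>0$ and the bandwidth is $W>0$. A link of length $r$ is, independently of all others, in line of sight (LOS) with probability $e^{-r/\mu}$; the pathloss from a tier-$i$ base station ${\bf x}$ is $L_i({\bf x})=\|{\bf x}\|^{\alpha_i}$ with the exponent $\alpha_i>0$ depending on whether the link is LOS. The fading gains $h_{\bf x}$ are i.i.d. exponential with mean $1$. The user is served by the base station ${\bf x}^*$ maximizing $P_iT_i\beta_iG_iG_{\rm u}L_i({\bf x})^{-1}$ over ${\bf x}\in\Phi_i$, $i\in\{{\rm m},{\rm s}\}$, where $P_i,T_i,\beta_i,G_i$ are transmit power, bias, reference loss and main-lobe antenna gain of tier $i$, and $G_{\rm u}$ is that of the user; let $\mathcal A_i=\mathbb P({\bf x}^*\in\Phi_i)$. Interference from macro base stations is neglected, so that for ${\bf x}^*\in\Phi_i$ $$\mathtt{SINR}_{\rm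 a}=\frac{P_iG_iG_{\rm u}\beta_ih_{{\bf x}^*}L_i({\bf x}^*)^{-1}}{\sum_{{\bf x}\in\Phi_{\rm s}\setminus\{{\bf x}^*\}}P_{\rm s}\beta_{\rm s}h_{\bf x}\psi_{\bf x}L_{\rm s}({\bf x})^{-1}+{\tt N}_0W},$$ where ${\tt N}_0>0$ is the noise spectral density and the $\psi_{\bf x}$ are i.i.d. effective gains of the sectorized (main lobe / side lobe) antennas of base station and user with uniformly distributed beam directions. The number $N$ of users sharing the tagged base station (including the typical one) is modelled as follows. Given ${\bf x}^*\in\Phi_i$, the area of a typical tier-$i$ cell is approximated by a Gamma variable with shape $3.5$ and mean $\mathcal A_i/\lambda_i$; the tagged cell has the area-biased version of this law; given its area $a$, $N-1$ is Poisson with mean $\lambda_{\rm u}a$; and the load is independent of the point processes, link states, fading and antenna gains. If every base station has fiber backhaul, the rate is $\mathtt{Rate}=\frac WN\log_2(1+\mathtt{SINR}_{\rm a})$, and the rate coverage is $\mathtt{P_r}(\rho)=\mathbb P(\mathtt{Rate}>\rho)$, $\rho\ge0$. Let $$\mathtt K_t(n;\lambda,\lambda_{\rm u})=\frac{3.5^{3.5}}{(n-1)!}\frac{\Gamma(n+3.5)}{\Gamma(3.5)}\Big(\frac{\lambda_{\rm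 u}}{\lambda}\Big)^{n-1}\Big(3.5+\frac{\lambda_{\rm u}}{\lambda}\Big)^{-n-3.5},\qquad n\ge1.$$ (1) For a single-tier macro-only network ($\lambda_{\rm s}=0$), $$\mathtt{P_r}(\rho)=\sum_{n=1}^\infty\mathbb P\big(\mathtt{SINR}_{\rm a}>2^{\rho n/W}-1\big)\,\mathtt K_t\Big(n;\frac{\lambda_{\rm m}}{\mathcal A_{\rm m}},\lambda_{\rm u}\Big).$$ (2) For a two-tier network with fiber-backhauled small cells ($\lambda_{\rm s}>0$), $$\mathtt{P_r}(\rho)=\sum_{i\in\{{\rm m},{\rm s}\}}\mathcal A_i\sum_{n=1}^\infty\mathbb P\big(\mathtt{SINR}_{\rm a}>2^{\rho n/W}-1\,\big|\,{\bf x}^*\in\Phi_i\big)\,\mathtt K_t\Big(n;\frac{\lambda_i}{\mathcal A_i},\lambda_{\rm u}\Big).$$ All these series converge. -/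

import Mathlib

open MeasureTheory ProbabilityTheory
open scoped ENNReal

noncomputable section

namespace MmWaveHetNet

/-- The two tiers of base stations (BSs): macro BSs and small-cell BSs. -/
inductive Tier
  | mbs
  | sbs
  deriving DecidableEq

/-- The plane `ℝ²` with the Euclidean norm and Lebesgue measure. -/
abbrev Plane := EuclideanSpace ℝ (Fin 2)

/-- The deterministic system parameters. -/
structure Params where
  /-- Density of the Poisson process of BSs of each tier. -/
  density : Tier → ℝ
  /-- Density of the Poisson process of users. -/
  userDensity : ℝ
  /-- Transmit power over the whole bandwidth. -/
  power : Tier → ℝ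
  /-- Association bias factor. -/
  bias : Tier → ℝ
  /-- Propagation loss of an access link at the reference distance. -/
  refLoss : Tier → ℝ
  /-- Main lobe gain of the BS antennas. -/
  gain : Tier → ℝ
  /-- Side lobe gain of the BS antennas. -/
  sideGain : Tier → ℝ
  /-- Main lobe beam width of the BS antennas. -/
  beamWidth : Tier → ℝ
  /-- Main lobe gain of the user antenna. -/
  userGain : ℝ
  /-- Side lobe gain of the user antenna. -/
  userSideGain : ℝ
  /-- Main lobe beam width of the user antenna. -/
  userBeamWidth : ℝ
  /-- Pathloss exponent of a line-of-sight access link. -/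
  expLOS : Tier → ℝ
  /-- Pathloss exponent of a non-line-of-sight access link. -/
  expNLOS : Tier → ℝ
  /-- LOS range constant `μ`. -/
  losRange : ℝ
  /-- Noise power spectral density `N₀`. -/
  noise : ℝ
  /-- System bandwidth `W`. -/
  bandwidth : ℝ
  density_mbs_pos : 0 < density .mbs
  density_sbs_nonneg : 0 ≤ density .sbs
  userDensity_pos : 0 < userDensity
  power_pos : ∀ i, 0 < power i
  bias_pos : ∀ i, 0 < bias i
  refLoss_pos : ∀ i, 0 < refLoss i
  gain_pos : ∀ i, 0 < gain i
  sideGain_nonneg : ∀ i, 0 ≤ sideGain i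
  beamWidth_pos : ∀ i, 0 < beamWidth i
  beamWidth_le : ∀ i, beamWidth i ≤ 2 * Real.pi
  userGain_pos : 0 < userGain
  userSideGain_nonneg : 0 ≤ userSideGain
  userBeamWidth_pos : 0 < userBeamWidth
  userBeamWidth_le : userBeamWidth ≤ 2 * Real.pi
  expLOS_pos : ∀ i, 0 < expLOS i
  expNLOS_pos : ∀ i, 0 < expNLOS i
  losRange_pos : 0 < losRange
  noise_pos : 0 < noise
  bandwidth_pos : 0 < bandwidth

/-! ### Point configurations and Poisson processes -/

/-- An enumerated point configuration `(N, x)` in the plane: its points are the `x n` with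
`n < N`, where `N ∈ {0, 1, 2, …, ∞}`. -/
abbrev Pattern := ℕ∞ × (ℕ → Plane)

/-- The number of points of a configuration in the set `B`. -/
def Pattern.count (x : Pattern) (B : Set Plane) : ℕ∞ :=
  {n : ℕ | (n : ℕ∞) < x.1 ∧ x.2 n ∈ B}.encard

/-- `Φ` is a homogeneous Poisson point process in the plane with the given density. -/
structure IsPoissonProcess {Ω : Type*} [MeasurableSpace Ω] (P : Measure Ω)
    (Φ : Ω → Pattern) (density : ℝ) : Prop where
  measurable : Measurable Φ
  count_law : ∀ B : Set Plane, MeasurableSet B → Bornology.IsBounded B → ∀ k : ℕ,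
    P {ω | (Φ ω).count B = k} = poissonMeasure (density * (volume B).toReal).toNNReal {k}
  count_indep : ∀ (m : ℕ) (B : Fin m → Set Plane), (∀ a, MeasurableSet (B a)) →
    (∀ a, Bornology.IsBounded (B a)) → Pairwise (fun a b => Disjoint (B a) (B b)) →
    iIndepFun (fun a ω => (Φ ω).count (B a)) P

/-! ### Marks of the access links

Each BS carries a mark `(u, h, ψ)` describing its link to the typical user at the origin: `u`
decides the blockage state, `h` is the fading gain, `ψ` is the effective antenna gain that the
user sees if the BS interferes. -/

/-- The mark `(u, h, ψ)` of a BS. -/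
abbrev Mark := ℝ × ℝ × ℝ

/-- Law of the effective antenna gain of an interfering link: the sectorized patterns of BS and
user, each pointing in an independent uniformly distributed direction. -/
def gainLaw (q : Params) (i : Tier) : Measure ℝ :=
  let a := q.beamWidth i
  let b := q.userBeamWidth
  let c := 4 * Real.pi ^ 2
  ENNReal.ofReal (a * b / c) • Measure.dirac (q.gain i * q.userGain)
    + ENNReal.ofReal (a * (2 * Real.pi - b) / c) • Measure.dirac (q.gain i * q.userSideGain)
    + ENNReal.ofReal ((2 * Real.pi - a) * b / c) • Measure.dirac (q.sideGain i * q.userGain)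
    + ENNReal.ofReal ((2 * Real.pi - a) * (2 * Real.pi - b) / c) •
        Measure.dirac (q.sideGain i * q.userSideGain)

/-- Law of a mark: `u` uniform on `[0, 1]`, `h` exponential with mean one (Rayleigh fading), and
`ψ` the random antenna gain, independent of each other. -/
def markLaw (q : Params) (i : Tier) : Measure Mark :=
  (volume.restrict (Set.Icc (0 : ℝ) 1)).prod ((expMeasure 1).prod (gainLaw q i))

/-- A realization of the access network: the BSs of both tiers and their marks. -/
abbrev Config := (Tier → Pattern) × (Tier → ℕ → Mark)

namespace Config

variable (q : Params) (c : Config)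

/-- The `n`-th point of tier `i` is actually present. -/
def Present (i : Tier) (n : ℕ) : Prop := (n : ℕ∞) < (c.1 i).1

/-- Distance of the `n`-th BS of tier `i` from the typical user at the origin. -/
def dist (i : Tier) (n : ℕ) : ℝ := ‖(c.1 i).2 n‖

/-- Fading gain `h` of the link. -/
def fading (i : Tier) (n : ℕ) : ℝ := (c.2 i n).2.1

/-- Antenna gain `ψ` of the link, when it is an interfering one. -/
def interfGain (i : Tier) (n : ℕ) : ℝ := (c.2 i n).2.2

/-- The link is in line of sight; given its length `r` this has probability `exp (-r / μ)`. -/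
def IsLOS (i : Tier) (n : ℕ) : Prop := (c.2 i n).1 ≤ Real.exp (-(c.dist i n) / q.losRange)

open Classical in
/-- Pathloss: `r ^ α` with the exponent of the link state. -/
def pathloss (i : Tier) (n : ℕ) : ℝ :=
  c.dist i n ^ (if c.IsLOS q i n then q.expLOS i else q.expNLOS i)

/-- Biased average received power. -/
def biasedPower (i : Tier) (n : ℕ) : ℝ :=
  q.power i * q.bias i * q.refLoss i * q.gain i * q.userGain * (c.pathloss q i n)⁻¹

/-- The BS `(i, n)` maximizes the biased average received power among all BSs. -/
def IsBest (i : Tier) (n : ℕ) : Prop :=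
  c.Present i n ∧ ∀ j k, c.Present j k → c.biasedPower q j k ≤ c.biasedPower q i n

open Classical in
/-- The tagged BS `x*` serving the typical user. Ties (an event of probability zero) are resolved
in favour of macro BSs and then of the smaller index; `none` only if there is no maximizer. -/
def serving : Option (Tier × ℕ) :=
  if ∃ n, c.IsBest q .mbs n then some (.mbs, sInf {n | c.IsBest q .mbs n})
  else if ∃ n, c.IsBest q .sbs n then some (.sbs, sInf {n | c.IsBest q .sbs n})
  else none

open Classical in
/-- Aggregate interference from the small-cell BSs other than the tagged BS; the interference from
macro BSs is neglected. -/
def interference (s : Tier × ℕ) : ℝ≥0∞ :=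
  ∑' k : ℕ, if c.Present .sbs k ∧ (.sbs, k) ≠ s then
      ENNReal.ofReal (q.power .sbs * c.fading .sbs k * q.refLoss .sbs * c.interfGain .sbs k
        * (c.pathloss q .sbs k)⁻¹)
    else 0

/-- `SINR` of the access link to the BS `s = (i, n)`. -/
def sinrFrom (s : Tier × ℕ) : ℝ :=
  (ENNReal.ofReal (q.power s.1 * q.gain s.1 * q.userGain * q.refLoss s.1 * c.fading s.1 s.2
      * (c.pathloss q s.1 s.2)⁻¹)
    / (c.interference q s + ENNReal.ofReal (q.noise * q.bandwidth))).toReal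

/-- `SINR` of the access link of the typical user to its tagged BS. -/
def sinr : ℝ := (c.serving q).elim 0 (c.sinrFrom q)

end Config

/-! ### The random network -/

/-- The random access network seen from the typical user: independent Poisson processes of macro
and small-cell BSs, independently marked. -/
structure AccessNetwork {Ω : Type*} [MeasurableSpace Ω] (P : Measure Ω) (q : Params) where
  points : Tier → Ω → Pattern
  marks : Tier → ℕ → Ω → Mark
  poisson : ∀ i, IsPoissonProcess P (points i) (q.density i)
  tiers_indep : IndepFun (points .mbs) (points .sbs) P
  marks_measurable : ∀ i n, Measurable (marks i n)
  marks_law : ∀ i n, P.map (marks i n) = markLaw q i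
  marks_indep : iIndepFun (fun s : Tier × ℕ => marks s.1 s.2) P
  points_marks_indep : IndepFun (fun ω i => points i ω) (fun ω i n => marks i n ω) P

namespace AccessNetwork

variable {Ω : Type*} [MeasurableSpace Ω] {P : Measure Ω} {q : Params} (M : AccessNetwork P q)

/-- The realization of the network. -/
def config (ω : Ω) : Config := (fun i => M.points i ω, fun i n => M.marks i n ω)

/-- The event that the typical user is served by tier `i`. -/
def servedBy (i : Tier) : Set Ω := {ω | ∃ n, (M.config ω).serving q = some (i, n)}

/-- The association probability of tier `i`. -/
def assocProb (i : Tier) : ℝ := P.real (M.servedBy i)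

/-- `SINR` of the access link of the typical user. -/
def sinr (ω : Ω) : ℝ := (M.config ω).sinr q

end AccessNetwork

/-! ### Load and rate -/

/-- Law of the area of the association cell that contains the typical user, when it is a cell of a
tier of density `d` with association probability `A`: the area of a typical cell is approximated by
a Gamma variable of shape `3.5` and mean `A / d`, and a cell covers a given point with probability
proportional to its area. -/
def taggedAreaLaw (d A : ℝ) : Measure ℝ :=
  (gammaMeasure 3.5 (3.5 * d / A)).withDensity (fun a => ENNReal.ofReal (a * d / A))

/-- The network together with the cell loads in the Gamma approximation. The tagged cell, if of tier
`i`, has area `cellArea i`; given its area `a`, it contains besides the typical user a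
Poisson number `otherUsers i` of users with mean `λᵤ a`. The correlation between load and the
access network is neglected. -/
structure LoadedNetwork {Ω : Type*} [MeasurableSpace Ω] (P : Measure Ω) (q : Params)
    extends AccessNetwork P q where
  cellArea : Tier → Ω → ℝ
  otherUsers : Tier → Ω → ℕ
  cellArea_measurable : ∀ i, Measurable (cellArea i)
  otherUsers_measurable : ∀ i, Measurable (otherUsers i)
  load_law : ∀ i, 0 < q.density i → ∀ B : Set ℝ, MeasurableSet B → ∀ k : ℕ,
    P {ω | cellArea i ω ∈ B ∧ otherUsers i ω = k}
      = ∫⁻ a in B, poissonMeasure (q.userDensity * a).toNNReal {k}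
          ∂(taggedAreaLaw (q.density i) (toAccessNetwork.assocProb i))
  load_indep : ∀ i, IndepFun (fun ω => (cellArea i ω, otherUsers i ω)) toAccessNetwork.config P

namespace LoadedNetwork

variable {Ω : Type*} [MeasurableSpace Ω] {P : Measure Ω} {q : Params} (M : LoadedNetwork P q)

/-- Number of users, including the typical one, in the tagged cell if it is of tier `i`. -/
def load (i : Tier) (ω : Ω) : ℕ := 1 + M.otherUsers i ω

/-- Rate of the typical user when every BS is connected to the core by fiber, so that the tagged BS
shares the whole bandwidth equally among its users. -/
def rate (ω : Ω) : ℝ :=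
  ((M.config ω).serving q).elim 0 fun s =>
    q.bandwidth / (M.load s.1 ω : ℝ) * Real.logb 2 (1 + M.sinr ω)

/-- Rate coverage: the probability that the rate exceeds the threshold `ρ`. -/
def rateCoverage (ρ : ℝ) : ℝ := P.real {ω | ρ < M.rate ω}

end LoadedNetwork

/-- The probability mass function `K_t(n; λ, λᵤ)`, for `n ≥ 1`. -/
def Kt (n : ℕ) (d u : ℝ) : ℝ :=
  (3.5 : ℝ) ^ (3.5 : ℝ) / ((n - 1).factorial : ℝ) * (Real.Gamma (n + 3.5) / Real.Gamma 3.5)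
    * (u / d) ^ (n - 1) * (3.5 + u / d) ^ (-(n : ℝ) - 3.5)

end MmWaveHetNet

end

namespace MmWaveHetNet

/-! ### The load distribution -/

/-! Given the serving tier `i` and the load `n`, the rate exceeds `ρ` exactly when the SINR exceeds
`2 ^ (ρ n / W) - 1`. The event "served by `i` with rate above `ρ`" is therefore a disjoint union
over `n` of an SINR event intersected with a load event. The load is independent of the
configuration, so each probability factors (`hasSum_servedBy_inter_lt_rate`); countable additivity
also gives convergence.

The load factor is `Kt`: area bias turns the Gamma law of shape 3.5 into one of shape 4.5, and a
Poisson variable mixed over a Gamma law is negative binomial (`lintegral_poisson_taggedAreaLaw`).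

It remains to add the two tiers. If small cells have density zero, their serving event is null;
otherwise dividing by `assocProb i` gives the conditional form. Geometry enters only through
measurability and this null event. -/

lemma taggedAreaLaw_zero_right (d : ℝ) : taggedAreaLaw d 0 = 0 := by
  -- The weight `a * d / 0` is `0`, so the measure vanishes.
  simp [taggedAreaLaw]

/-- The density of the tagged area law times the Poisson weight is a multiple of a Gamma
density. -/
lemma gammaPDFReal_mul_poisson {c u : ℝ} (hc : 0 < c) (hu : 0 < u) (k : ℕ) {a : ℝ}
    (ha : 0 < a) :
    gammaPDFReal 3.5 (3.5 * c) a * (a * c * (Real.exp (-(u * a)) * (u * a) ^ k / k.factorial))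
      = Kt (k + 1) c u * gammaPDFReal (k + 4.5) (u + 3.5 * c) a := by
  -- The shape grows by one from the area bias and by `k` from the Poisson weight.
  have hpow : a ^ ((k : ℝ) + 4.5 - 1) = a ^ ((3.5 : ℝ) - 1) * a * a ^ k := by
    rw [show (k : ℝ) + 4.5 - 1 = (3.5 - 1) + 1 + k by ring, Real.rpow_add ha, Real.rpow_add ha,
      Real.rpow_one, Real.rpow_natCast]
  have hexp : Real.exp (-((u + 3.5 * c) * a))
      = Real.exp (-(u * a)) * Real.exp (-(3.5 * c * a)) := by
    rw [← Real.exp_add]; congr 1; ring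
  have hrate : u + 3.5 * c = c * (3.5 + u / c) := by field_simp; ring
  have hcpow : c ^ ((k : ℝ) + 4.5) = c ^ (3.5 : ℝ) * c * c ^ k := by
    rw [show (k : ℝ) + 4.5 = 3.5 + 1 + k by ring, Real.rpow_add hc, Real.rpow_add hc,
      Real.rpow_one, Real.rpow_natCast]
  have hs : 0 < 3.5 + u / c := by positivity
  have hG : Real.Gamma ((k : ℝ) + 4.5) ≠ 0 := (Real.Gamma_pos_of_pos (by positivity)).ne'
  have hG' : Real.Gamma (3.5 : ℝ) ≠ 0 := (Real.Gamma_pos_of_pos (by norm_num)).ne'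
  have hsp : (3.5 + u / c) ^ (-((k : ℝ) + 4.5)) * (3.5 + u / c) ^ ((k : ℝ) + 4.5) = 1 := by
    rw [← Real.rpow_add hs, neg_add_cancel, Real.rpow_zero]
  have hf : (k.factorial : ℝ) ≠ 0 := by positivity
  rw [gammaPDFReal, gammaPDFReal, if_pos ha.le, if_pos ha.le, hpow, hexp, Kt, hrate,
    Real.mul_rpow hc.le hs.le, hcpow, Real.mul_rpow (by norm_num) hc.le]
  simp only [Nat.add_sub_cancel, Nat.cast_add, Nat.cast_one]
  rw [show (k : ℝ) + 1 + 3.5 = k + 4.5 by ring,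
    show -((k : ℝ) + 1) - 3.5 = -(k + 4.5) by ring, mul_pow, div_pow]
  -- With the powers as atoms the identity is algebraic, up to `S * T = 1`: the last factor of `Kt`
  -- cancels the normalization of the Gamma density.
  generalize (3.5 + u / c) ^ (-((k : ℝ) + 4.5)) = S at *
  generalize (3.5 + u / c) ^ ((k : ℝ) + 4.5) = T at *
  generalize Real.Gamma ((k : ℝ) + 4.5) = G at *
  generalize Real.Gamma (3.5 : ℝ) = G' at *
  generalize (3.5 : ℝ) ^ (3.5 : ℝ) = x1
  generalize c ^ (3.5 : ℝ) = x2
  generalize a ^ ((3.5 : ℝ) - 1) = x3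
  generalize Real.exp (-(u * a)) = x4
  generalize Real.exp (-(3.5 * c * a)) = x5
  field_simp
  linear_combination (-(x1 * x2 * x3 * x4 * x5)) * hsp

lemma Kt_nonneg {c u : ℝ} (hc : 0 < c) (hu : 0 < u) (n : ℕ) : 0 ≤ Kt n c u := by
  have h1 : 0 < Real.Gamma ((n : ℝ) + 3.5) := Real.Gamma_pos_of_pos (by positivity)
  have h2 : 0 < Real.Gamma (3.5 : ℝ) := Real.Gamma_pos_of_pos (by norm_num)
  unfold Kt
  positivity

/-- A Poisson variable mixed over the tagged area law has probability mass function `Kt`. -/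
lemma lintegral_poisson_taggedAreaLaw {d A u : ℝ} (hd : 0 < d) (hA : 0 < A) (hu : 0 < u)
    (k : ℕ) :
    ∫⁻ a, poissonMeasure (u * a).toNNReal {k} ∂(taggedAreaLaw d A)
      = ENNReal.ofReal (Kt (k + 1) (d / A) u) := by
  have hc : 0 < d / A := div_pos hd hA
  have hmeas : Measurable fun a : ℝ => poissonMeasure (u * a).toNNReal {k} := by
    simp_rw [poissonMeasure_singleton]
    fun_prop
  have hg : ∀ x y : ℝ, Measurable (gammaPDF x y) := fun x y =>
    (measurable_gammaPDFReal x y).ennreal_ofReal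
  rw [taggedAreaLaw, lintegral_withDensity_eq_lintegral_mul _ (by fun_prop) hmeas, gammaMeasure,
    lintegral_withDensity_eq_lintegral_mul _ (hg _ _)
      (Measurable.mul (by fun_prop) hmeas)]
  calc _ = ∫⁻ a, ENNReal.ofReal (Kt (k + 1) (d / A) u)
        * gammaPDF (k + 4.5) (u + 3.5 * (d / A)) a := by
        -- The pointwise identity needs `0 < a`; for `a < 0` both Gamma densities vanish.
        have h0 : ∀ᵐ a : ℝ, a ≠ 0 := by simp [ae_iff]
        refine lintegral_congr_ae (h0.mono fun a ha => ?_)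
        rcases lt_or_gt_of_ne ha with h | h
        · simp [gammaPDF_of_neg h]
        · simp only [Pi.mul_apply, poissonMeasure_singleton, gammaPDF]
          rw [← ENNReal.ofReal_mul (by positivity),
            ← ENNReal.ofReal_mul (gammaPDFReal_nonneg (by norm_num) (by positivity) _),
            ← ENNReal.ofReal_mul (Kt_nonneg hc hu _), ← gammaPDFReal_mul_poisson hc hu k h,
            Real.coe_toNNReal _ (by positivity), mul_div_assoc, mul_div_assoc]
    _ = _ := by
        rw [lintegral_const_mul _ (hg _ _),
          lintegral_gammaPDF_eq_one (by positivity) (by positivity), mul_one]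

namespace LoadedNetwork

variable {Ω : Type*} [MeasurableSpace Ω] {P : Measure Ω} {q : Params}

lemma measure_otherUsers_eq (M : LoadedNetwork P q) {i : Tier} (hi : 0 < q.density i) (k : ℕ) :
    P {ω | M.otherUsers i ω = k}
      = ∫⁻ a, poissonMeasure (q.userDensity * a).toNNReal {k}
          ∂(taggedAreaLaw (q.density i) (M.assocProb i)) := by
  simpa using M.load_law i hi Set.univ MeasurableSet.univ k

/-- This follows from the load law alone: were the probability zero, the tagged area law would be
the zero measure, and the null events `otherUsers i = k` would cover `Ω`. -/
lemma assocProb_pos [IsProbabilityMeasure P] (M : LoadedNetwork P q) {i : Tier}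
    (hi : 0 < q.density i) : 0 < M.assocProb i := by
  refine lt_of_le_of_ne measureReal_nonneg fun h => ?_
  have h0 : ∀ k, P {ω | M.otherUsers i ω = k} = 0 := fun k => by
    rw [M.measure_otherUsers_eq hi, ← h, taggedAreaLaw_zero_right, lintegral_zero_measure]
  have : P (⋃ k, {ω | M.otherUsers i ω = k}) = 0 := measure_iUnion_null h0
  rw [show (⋃ k, {ω | M.otherUsers i ω = k}) = Set.univ by ext; simp] at this
  simp at this

lemma measure_real_otherUsers_eq [IsProbabilityMeasure P] (M : LoadedNetwork P q) {i : Tier}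
    (hi : 0 < q.density i) (k : ℕ) :
    P.real {ω | M.otherUsers i ω = k}
      = Kt (k + 1) (q.density i / M.assocProb i) q.userDensity := by
  rw [measureReal_def, M.measure_otherUsers_eq hi,
    lintegral_poisson_taggedAreaLaw hi (M.assocProb_pos hi) q.userDensity_pos,
    ENNReal.toReal_ofReal (Kt_nonneg (div_pos hi (M.assocProb_pos hi)) q.userDensity_pos _)]

end LoadedNetwork

/-! ### Measurability of the association and of the SINR -/

namespace Config

variable (q : Params)

lemma measurableSet_present (i : Tier) (n : ℕ) : MeasurableSet {c : Config | c.Present i n} := by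
  have h : Measurable fun c : Config => (c.1 i).1 := by fun_prop
  exact h (MeasurableSet.of_discrete (s := {m : ℕ∞ | (n : ℕ∞) < m}))

lemma measurable_dist (i : Tier) (n : ℕ) : Measurable fun c : Config => c.dist i n := by
  unfold dist
  fun_prop

lemma measurableSet_isLOS (i : Tier) (n : ℕ) :
    MeasurableSet {c : Config | c.IsLOS q i n} := by
  have := measurable_dist i n
  exact measurableSet_le (by fun_prop) (by fun_prop)

@[fun_prop]
lemma measurable_pathloss (i : Tier) (n : ℕ) :
    Measurable fun c : Config => c.pathloss q i n := by
  classical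
  exact (measurable_dist i n).pow
    (Measurable.ite (measurableSet_isLOS q i n) measurable_const measurable_const)

@[fun_prop]
lemma measurable_biasedPower (i : Tier) (n : ℕ) :
    Measurable fun c : Config => c.biasedPower q i n := by
  unfold biasedPower
  fun_prop

lemma measurableSet_isBest (i : Tier) (n : ℕ) :
    MeasurableSet {c : Config | c.IsBest q i n} := by
  have h (j : Tier) (k : ℕ) : MeasurableSet
      {c : Config | c.Present j k → c.biasedPower q j k ≤ c.biasedPower q i n} :=
    (measurableSet_present j k).imp (measurableSet_le (by fun_prop) (by fun_prop))
  have e : {c : Config | c.IsBest q i n} = {c : Config | c.Present i n} ∩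
      ((⋂ k, {c : Config | c.Present .mbs k → c.biasedPower q .mbs k ≤ c.biasedPower q i n}) ∩
        ⋂ k, {c : Config | c.Present .sbs k → c.biasedPower q .sbs k ≤ c.biasedPower q i n}) := by
    ext c
    simp only [IsBest, Set.mem_ofPred_eq, Set.mem_inter_iff, Set.mem_iInter]
    refine and_congr_right fun _ => ⟨fun H => ⟨H _, H _⟩, fun H j => ?_⟩
    cases j
    exacts [H.1, H.2]
  rw [e]
  exact (measurableSet_present i n).inter
    ((MeasurableSet.iInter (h _)).inter (MeasurableSet.iInter (h _)))

/-- Nonemptiness excludes the default `sInf ∅ = 0`. This turns the choice of server into countably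
many `IsBest` conditions, which are measurable. -/
lemma nat_sInf_eq_iff {S : Set ℕ} (hS : S.Nonempty) {n : ℕ} :
    sInf S = n ↔ n ∈ S ∧ ∀ k < n, k ∉ S := by
  constructor
  · rintro rfl
    exact ⟨Nat.sInf_mem hS, fun k hk => Nat.notMem_of_lt_sInf hk⟩
  · rintro ⟨h1, h2⟩
    exact le_antisymm (Nat.sInf_le h1) (not_lt.1 fun h => h2 _ h (Nat.sInf_mem hS))

lemma serving_eq_mbs_iff (c : Config) (n : ℕ) :
    c.serving q = some (.mbs, n) ↔ c.IsBest q .mbs n ∧ ∀ k < n, ¬ c.IsBest q .mbs k := by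
  unfold serving
  split_ifs with h1 h2
  · simpa using nat_sInf_eq_iff (S := {n | c.IsBest q .mbs n}) h1
  · simp only [Option.some.injEq, Prod.mk.injEq, reduceCtorEq, false_and, false_iff]
    exact fun h => h1 ⟨n, h.1⟩
  · simp only [false_iff]
    exact fun h => h1 ⟨n, h.1⟩

lemma serving_eq_sbs_iff (c : Config) (n : ℕ) :
    c.serving q = some (.sbs, n) ↔
      (∀ k, ¬ c.IsBest q .mbs k) ∧ c.IsBest q .sbs n ∧ ∀ k < n, ¬ c.IsBest q .sbs k := by
  unfold serving
  split_ifs with h1 h2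
  · simp only [Option.some.injEq, Prod.mk.injEq, reduceCtorEq, false_and, false_iff]
    exact fun h => h1.elim h.1
  · have h3 : ∀ k, ¬ c.IsBest q .mbs k := fun k hk => h1 ⟨k, hk⟩
    simpa [h3] using nat_sInf_eq_iff (S := {n | c.IsBest q .sbs n}) h2
  · simp only [false_iff]
    exact fun h => h2 ⟨n, h.2.1⟩

lemma isBest_of_serving_eq {c : Config} {i : Tier} {n : ℕ} (h : c.serving q = some (i, n)) :
    c.IsBest q i n := by
  cases i
  · exact ((serving_eq_mbs_iff q c n).1 h).1
  · exact ((serving_eq_sbs_iff q c n).1 h).2.1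

lemma measurableSet_serving_eq (i : Tier) (n : ℕ) :
    MeasurableSet {c : Config | c.serving q = some (i, n)} := by
  have h (j : Tier) (k : ℕ) : MeasurableSet {c : Config | ¬ c.IsBest q j k} :=
    (measurableSet_isBest q j k).compl
  have hlt (j : Tier) : MeasurableSet {c : Config | ∀ k < n, ¬ c.IsBest q j k} := by
    simp only [Set.ofPred_forall]
    exact MeasurableSet.iInter fun k => MeasurableSet.iInter fun _ => h j k
  cases i
  · simp only [serving_eq_mbs_iff]
    exact (measurableSet_isBest q _ n).inter (hlt _)
  · simp only [serving_eq_sbs_iff]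
    refine MeasurableSet.inter (s₁ := {c : Config | ∀ k, ¬ c.IsBest q .mbs k}) ?_
      ((measurableSet_isBest q _ n).inter (hlt _))
    simp only [Set.ofPred_forall]
    exact MeasurableSet.iInter fun k => h _ k

@[fun_prop]
lemma measurable_fading (i : Tier) (n : ℕ) : Measurable fun c : Config => c.fading i n := by
  unfold fading
  fun_prop

@[fun_prop]
lemma measurable_interfGain (i : Tier) (n : ℕ) :
    Measurable fun c : Config => c.interfGain i n := by
  unfold interfGain
  fun_prop

@[fun_prop]
lemma measurable_interference (s : Tier × ℕ) :
    Measurable fun c : Config => c.interference q s := by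
  unfold interference
  refine Measurable.tsum fun k => Measurable.ite ?_ (by fun_prop) measurable_const
  exact (measurableSet_present _ k).inter (MeasurableSet.const _)

@[fun_prop]
lemma measurable_sinrFrom (s : Tier × ℕ) : Measurable fun c : Config => c.sinrFrom q s := by
  unfold sinrFrom
  fun_prop

lemma sinr_nonneg (c : Config) : 0 ≤ c.sinr q := by
  unfold sinr
  rcases c.serving q with _ | s
  · exact le_rfl
  · exact ENNReal.toReal_nonneg

/-- The configurations in which the user is served by tier `i` with an SINR exceeding `τ`. -/
def coverage (i : Tier) (τ : ℝ) : Set Config :=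
  {c | (∃ n, c.serving q = some (i, n)) ∧ τ < c.sinr q}

lemma measurableSet_coverage (i : Tier) (τ : ℝ) : MeasurableSet (coverage q i τ) := by
  -- Once the serving index is fixed, `sinr` is the measurable function `sinrFrom` at that index.
  have e : coverage q i τ
      = ⋃ n, {c : Config | c.serving q = some (i, n)} ∩ {c : Config | τ < c.sinrFrom q (i, n)} := by
    ext c
    simp only [coverage, Set.mem_ofPred_eq, Set.mem_iUnion, Set.mem_inter_iff, ← exists_and_right]
    refine exists_congr fun n => and_congr_right fun h => ?_
    simp [sinr, h]
  rw [e]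
  exact MeasurableSet.iUnion fun n => (measurableSet_serving_eq q i n).inter
    (measurableSet_lt measurable_const (by fun_prop))

end Config

/-! ### Void events, association events and tiers of density zero. -/

lemma Pattern.measurableSet_count_eq_zero {B : Set Plane} (hB : MeasurableSet B) :
    MeasurableSet {x : Pattern | x.count B = 0} := by
  have e : {x : Pattern | x.count B = 0} =
      ⋂ n : ℕ, ({x : Pattern | (n : ℕ∞) < x.1} ∩ {x : Pattern | x.2 n ∈ B})ᶜ := by
    ext x
    simp [Pattern.count, Set.eq_empty_iff_forall_notMem]
  rw [e]
  refine MeasurableSet.iInter fun n => (MeasurableSet.inter ?_ ?_).compl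
  · exact measurable_fst (MeasurableSet.of_discrete (s := {m : ℕ∞ | (n : ℕ∞) < m}))
  · exact ((measurable_pi_apply n).comp measurable_snd) hB

namespace AccessNetwork

variable {Ω : Type*} [MeasurableSpace Ω] {P : Measure Ω} {q : Params}

lemma measurable_config (M : AccessNetwork P q) : Measurable M.config :=
  (measurable_pi_lambda _ fun i => (M.poisson i).measurable).prodMk
    (measurable_pi_lambda _ fun i => measurable_pi_lambda _ fun n => M.marks_measurable i n)

lemma measurableSet_servedBy (M : AccessNetwork P q) (i : Tier) :
    MeasurableSet (M.servedBy i) := by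
  have : M.servedBy i = M.config ⁻¹' ⋃ n, {c : Config | c.serving q = some (i, n)} := by
    ext ω; simp [servedBy]
  rw [this]
  exact M.measurable_config (MeasurableSet.iUnion fun n => Config.measurableSet_serving_eq q i n)

lemma disjoint_servedBy (M : AccessNetwork P q) : Disjoint (M.servedBy .mbs) (M.servedBy .sbs) := by
  rw [Set.disjoint_left]
  rintro ω ⟨n, hn⟩ ⟨m, hm⟩
  simp [hn] at hm

lemma preimage_coverage (M : AccessNetwork P q) (i : Tier) (τ : ℝ) :
    M.config ⁻¹' Config.coverage q i τ = M.servedBy i ∩ {ω | τ < M.sinr ω} := rfl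

/-- The user is almost surely not served by a tier of density zero. -/
lemma measure_servedBy_eq_zero [IsProbabilityMeasure P] (M : AccessNetwork P q) {i : Tier} (hi : q.density i = 0) :
    P (M.servedBy i) = 0 := by
  -- The count has Poisson mean `0`, so it is zero with probability one; balls of integer radius
  -- exhaust the plane.
  have hball (R : ℕ) : ∀ᵐ ω ∂P, (M.points i ω).count (Metric.ball 0 R) = 0 := by
    have hm : MeasurableSet {x : Pattern | x.count (Metric.ball 0 R) = 0} :=
      Pattern.measurableSet_count_eq_zero measurableSet_ball
    have h := (M.poisson i).count_law (Metric.ball 0 R) measurableSet_ball Metric.isBounded_ball 0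
    refine (mem_ae_iff_prob_eq_one ((M.poisson i).measurable hm)).2 ?_
    simpa [hi, poissonMeasure_singleton] using h
  rw [← ae_all_iff] at hball
  refine measure_mono_null ?_ hball
  rintro ω ⟨n, hn⟩ h
  have hp : (n : ℕ∞) < (M.points i ω).1 := (Config.isBest_of_serving_eq q hn).1
  obtain ⟨R, hR⟩ := exists_nat_gt ‖(M.points i ω).2 n‖
  have := h R
  rw [Pattern.count, Set.encard_eq_zero] at this
  exact this.subset (show n ∈ _ from ⟨hp, by simpa using hR⟩)

end AccessNetwork

/-! ### Rate coverage -/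

lemma hasSum_measureReal_iUnion {Ω ι : Type*} [MeasurableSpace Ω] {P : Measure Ω}
    [IsFiniteMeasure P] [Countable ι] {s : ι → Set Ω}
    (hd : Pairwise fun a b => Disjoint (s a) (s b)) (hs : ∀ a, MeasurableSet (s a)) :
    HasSum (fun a => P.real (s a)) (P.real (⋃ a, s a)) := by
  have h := measure_iUnion (μ := P) hd hs
  rw [measureReal_def, h, ENNReal.tsum_toReal_eq fun a => measure_ne_top P _]
  exact (ENNReal.summable_toReal (h ▸ measure_ne_top P _)).hasSum

namespace LoadedNetwork

variable {Ω : Type*} [MeasurableSpace Ω] {P : Measure Ω} {q : Params}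

/-- The SINR threshold for the rate `ρ` when `n` users share the bandwidth. -/
lemma lt_rate_iff_lt_sinr {W ρ x : ℝ} (hW : 0 < W) (hx : 0 ≤ x) {n : ℕ} (hn : 0 < n) :
    ρ < W / n * Real.logb 2 (1 + x) ↔ (2 : ℝ) ^ (ρ * n / W) - 1 < x := by
  have hn' : (0 : ℝ) < n := by exact_mod_cast hn
  rw [sub_lt_iff_lt_add', ← Real.lt_logb_iff_rpow_lt one_lt_two (by positivity),
    div_lt_iff₀ hW, div_mul_eq_mul_div, lt_div_iff₀ hn', mul_comm W]

/-- The index `n` counts all users of the cell, the typical one included, so the others number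
`n.natPred`. -/
lemma servedBy_inter_lt_rate (M : LoadedNetwork P q) (i : Tier) (ρ : ℝ) :
    M.servedBy i ∩ {ω | ρ < M.rate ω}
      = ⋃ n : ℕ+, M.servedBy i ∩ {ω | (2 : ℝ) ^ (ρ * n / q.bandwidth) - 1 < M.sinr ω}
          ∩ {ω | M.otherUsers i ω = n.natPred} := by
  ext ω
  simp only [Set.mem_inter_iff, Set.mem_iUnion, Set.mem_ofPred_eq]
  have key (hs : ω ∈ M.servedBy i) : ρ < M.rate ω ↔
      (2 : ℝ) ^ (ρ * (M.load i ω) / q.bandwidth) - 1 < M.sinr ω := by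
    obtain ⟨m, hm⟩ := hs
    have hr : M.rate ω = q.bandwidth / (M.load i ω : ℝ) * Real.logb 2 (1 + M.sinr ω) := by
      simp [rate, hm]
    rw [hr]
    exact lt_rate_iff_lt_sinr q.bandwidth_pos (Config.sinr_nonneg q _)
      (by unfold load; positivity)
  constructor
  · rintro ⟨hs, h⟩
    refine ⟨⟨M.load i ω, by unfold load; positivity⟩, ⟨hs, ?_⟩, ?_⟩
    · simpa using (key hs).1 h
    · simp [PNat.natPred, load]
  · rintro ⟨n, ⟨hs, h⟩, hn⟩
    refine ⟨hs, (key hs).2 ?_⟩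
    have : M.load i ω = n := by rw [load, hn, add_comm, PNat.natPred_add_one]
    rwa [this]

/-- The rate coverage restricted to the users of one tier. -/
lemma hasSum_servedBy_inter_lt_rate [IsProbabilityMeasure P] (M : LoadedNetwork P q) {i : Tier}
    (hi : 0 < q.density i) (ρ : ℝ) :
    HasSum (fun n : ℕ+ =>
        P.real (M.servedBy i ∩ {ω | (2 : ℝ) ^ (ρ * n / q.bandwidth) - 1 < M.sinr ω})
          * Kt n (q.density i / M.assocProb i) q.userDensity)
      (P.real (M.servedBy i ∩ {ω | ρ < M.rate ω})) := by
  have hcov (τ : ℝ) : MeasurableSet (M.servedBy i ∩ {ω | τ < M.sinr ω}) :=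
    M.measurable_config (Config.measurableSet_coverage q i τ)
  have hload (k : ℕ) : MeasurableSet {ω | M.otherUsers i ω = k} :=
    M.otherUsers_measurable i (measurableSet_singleton k)
  have hterm (n : ℕ+) :
      P.real (M.servedBy i ∩ {ω | (2 : ℝ) ^ (ρ * n / q.bandwidth) - 1 < M.sinr ω})
          * Kt n (q.density i / M.assocProb i) q.userDensity
        = P.real (M.servedBy i ∩ {ω | (2 : ℝ) ^ (ρ * n / q.bandwidth) - 1 < M.sinr ω}
          ∩ {ω | M.otherUsers i ω = n.natPred}) := by
    -- The load event depends on area and user count only, the coverage event on the configuration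
    -- only.
    have h := indepFun_iff_measure_inter_preimage_eq_mul.1 (M.load_indep i)
      (Prod.snd ⁻¹' {n.natPred}) (Config.coverage q i ((2 : ℝ) ^ (ρ * n / q.bandwidth) - 1))
      (measurable_snd (measurableSet_singleton _)) (Config.measurableSet_coverage q i _)
    rw [AccessNetwork.preimage_coverage, Set.inter_comm, mul_comm (P _)] at h
    have hK := M.measure_real_otherUsers_eq hi n.natPred
    rw [PNat.natPred_add_one] at hK
    rw [← hK, measureReal_def, measureReal_def, measureReal_def, ← ENNReal.toReal_mul]
    exact congrArg ENNReal.toReal h.symm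
  simp_rw [hterm]
  rw [servedBy_inter_lt_rate]
  refine hasSum_measureReal_iUnion ?_ ?_
  · intro m n hmn
    refine Set.disjoint_left.2 fun ω hm hn => hmn ?_
    exact PNat.natPred_injective (hm.2.symm.trans hn.2)
  · exact fun n => (hcov _).inter (hload _)

/-- Without a server the rate is `0` by default, which cannot exceed `ρ ≥ 0`; hence existence of a
maximizer is never needed. -/
lemma setOf_lt_rate_subset (M : LoadedNetwork P q) {ρ : ℝ} (hρ : 0 ≤ ρ) :
    {ω | ρ < M.rate ω} ⊆ M.servedBy .mbs ∪ M.servedBy .sbs := by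
  intro ω h
  rcases hs : (M.config ω).serving q with _ | ⟨_ | _, n⟩
  · simp only [Set.mem_ofPred_eq, rate, hs, Option.elim_none] at h
    exact absurd h hρ.not_gt
  · exact Or.inl ⟨n, hs⟩
  · exact Or.inr ⟨n, hs⟩

lemma setOf_lt_sinr_subset (M : AccessNetwork P q) {τ : ℝ} (hτ : 0 ≤ τ) :
    {ω | τ < M.sinr ω} ⊆ M.servedBy .mbs ∪ M.servedBy .sbs := by
  intro ω h
  rcases hs : (M.config ω).serving q with _ | ⟨_ | _, n⟩
  · simp only [Set.mem_ofPred_eq, AccessNetwork.sinr, Config.sinr, hs, Option.elim_none] at h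
    exact absurd h hτ.not_gt
  · exact Or.inl ⟨n, hs⟩
  · exact Or.inr ⟨n, hs⟩

lemma measureReal_eq_of_subset_servedBy [IsFiniteMeasure P] (M : AccessNetwork P q) {E : Set Ω}
    (hE : E ⊆ M.servedBy .mbs ∪ M.servedBy .sbs) :
    P.real E = P.real (M.servedBy .mbs ∩ E) + P.real (M.servedBy .sbs ∩ E) := by
  rw [← measureReal_inter_add_sdiff (s := E) (M.measurableSet_servedBy .mbs), Set.inter_comm]
  congr 2
  ext ω
  constructor
  · rintro ⟨h1, h2⟩
    exact ⟨(hE h1).resolve_left h2, h1⟩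
  · rintro ⟨h1, h2⟩
    exact ⟨h2, Set.disjoint_right.1 M.disjoint_servedBy h1⟩

end LoadedNetwork

end MmWaveHetNet

open MmWaveHetNet in
theorem mainTheorem9 {Ω : Type*} [MeasurableSpace Ω] (P : Measure Ω) [IsProbabilityMeasure P]
    (q : Params) (M : LoadedNetwork P q) (ρ : ℝ) (hρ : 0 ≤ ρ) :
    -- single-tier macro-only network
    (q.density .sbs = 0 →
      HasSum
        (fun n : ℕ+ => P.real {ω | (2 : ℝ) ^ (ρ * n / q.bandwidth) - 1 < M.sinr ω}
          * Kt n (q.density .mbs / M.assocProb .mbs) q.userDensity)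
        (M.rateCoverage ρ)) ∧
    -- two-tier network with fiber-backhauled small cells
    (0 < q.density .sbs →
      (∀ i : Tier, Summable
        (fun n : ℕ+ => (P[|M.servedBy i]).real {ω | (2 : ℝ) ^ (ρ * n / q.bandwidth) - 1 < M.sinr ω}
          * Kt n (q.density i / M.assocProb i) q.userDensity)) ∧
      M.rateCoverage ρ =
        M.assocProb .mbs *
          ∑' n : ℕ+, (P[|M.servedBy .mbs]).real
              {ω | (2 : ℝ) ^ (ρ * n / q.bandwidth) - 1 < M.sinr ω}
            * Kt n (q.density .mbs / M.assocProb .mbs) q.userDensity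
        + M.assocProb .sbs *
          ∑' n : ℕ+, (P[|M.servedBy .sbs]).real
              {ω | (2 : ℝ) ^ (ρ * n / q.bandwidth) - 1 < M.sinr ω}
            * Kt n (q.density .sbs / M.assocProb .sbs) q.userDensity) := by
  have hτ (n : ℕ+) : 0 ≤ (2 : ℝ) ^ (ρ * n / q.bandwidth) - 1 :=
    sub_nonneg.2 (Real.one_le_rpow one_le_two
      (div_nonneg (mul_nonneg hρ (Nat.cast_nonneg _)) q.bandwidth_pos.le))
  refine ⟨fun h0 => ?_, fun hs => ?_⟩
  · have hnull (E : Set Ω) : P.real (M.servedBy .sbs ∩ E) = 0 := by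
      rw [measureReal_def, measure_mono_null Set.inter_subset_left
        (M.measure_servedBy_eq_zero h0), ENNReal.toReal_zero]
    have h := M.hasSum_servedBy_inter_lt_rate q.density_mbs_pos ρ
    rw [LoadedNetwork.rateCoverage,
      LoadedNetwork.measureReal_eq_of_subset_servedBy _ (M.setOf_lt_rate_subset hρ), hnull,
      add_zero]
    -- Nonnegative thresholds exclude the unserved outcomes and the small-cell part is null, so the
    -- unconditional SINR probability is the macro-served one.
    refine h.congr_fun fun n => ?_
    rw [LoadedNetwork.measureReal_eq_of_subset_servedBy _
      (LoadedNetwork.setOf_lt_sinr_subset _ (hτ n)), hnull, add_zero]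
  · have hd : ∀ i, 0 < q.density i := fun i => by
      cases i
      exacts [q.density_mbs_pos, hs]
    have hsum (i : Tier) : HasSum
        (fun n : ℕ+ => (P[|M.servedBy i]).real
            {ω | (2 : ℝ) ^ (ρ * n / q.bandwidth) - 1 < M.sinr ω}
          * Kt n (q.density i / M.assocProb i) q.userDensity)
        ((M.assocProb i)⁻¹ * P.real (M.servedBy i ∩ {ω | ρ < M.rate ω})) := by
      -- Conditioning on the tier multiplies each term by `(assocProb i)⁻¹`, which the prefactor
      -- `assocProb i` later cancels.
      refine ((M.hasSum_servedBy_inter_lt_rate (hd i) ρ).mul_left _).congr_fun fun n => ?_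
      rw [measureReal_def, cond_apply (M.measurableSet_servedBy i), ENNReal.toReal_mul,
        ENNReal.toReal_inv, mul_assoc]
      rfl
    refine ⟨fun i => (hsum i).summable, ?_⟩
    rw [(hsum .mbs).tsum_eq, (hsum .sbs).tsum_eq,
      mul_inv_cancel_left₀ (M.assocProb_pos (hd _)).ne',
      mul_inv_cancel_left₀ (M.assocProb_pos (hd _)).ne', LoadedNetwork.rateCoverage]
    exact LoadedNetwork.measureReal_eq_of_subset_servedBy _ (M.setOf_lt_rate_subset hρ)
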